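/- All spaces are Tychonoff, and all maps are continuous and are considered as maps onto their images; maps $\varphi\colon X\to\varphi(X)$ and $\psi\colon X\to\psi(X)$ are identified if $\psi=h\circ\varphi$ for a homeomorphism $h\colon\varphi(X)\to\psi(X)$. The weight $w(X)$ is the maximum of $\aleph_0$ and the least cardinality of a base of $X$. A perfect map is a closed map with compact fibers. A map $f\colon X\to Y$ is skeletal if $\operatorname{Int}_Y\operatorname{cl}_Y f(U)\neq\varnothing$ for every non-empty open $U\subset X$; a surjection $f\colon X\to Y$ is irreducible if $f(F)\neq Y$ for every proper closed subset $F\subset X$. Two spaces are co-absolute if they have a common absolute, that is, if there is an extremally disconnected space admitting perfect irreducible maps onto both of them. A Lindelöf $p$-space is a space admitting a perfect map onto a separable metric space. For maps $\varphi,f$ with domain $X$, write $\varphi\prec f$ if $f=g\circ\varphi$ for some continuous $g\colon\varphi(X)\to f(X)$. A multiplicative lattice on $X$ is a family $\Psi$ of maps with domain $X$ such that (L1) for every map $f\colon X\to f(X)$ there is $\varphi\in\Psi$ with $\varphi\prec f$ and $w(\varphi(X))\le w(f(X))$; (L2) for every non-empty family $\{\varphi_\alpha:\alpha\in A\}\subset\Psi$,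 the diagonal product $\triangle\{\varphi_\alpha:\alpha\in A\}$ belongs to $\Psi$. **Corollary 2.4.** Let $Y$ be a Lindelöf $p$-space which is co-absolute with a space $X$ possessing a multiplicative lattice consisting of open maps. Then $Y$ has a multiplicative lattice consisting of maps that are both perfect and skeletal. -/

import Mathlib

universe u

open Cardinal Topology

namespace SkeletalLattice

/-- The weight `w(X)`: the least cardinality of a base of `X`, with the usual convention that
values of cardinal functions are infinite (so `w(X) = ℵ₀` for every second countable `X`). -/
noncomputable def weight (X : Type u) [TopologicalSpace X] : Cardinal.{u} :=
  max ℵ₀ (sInf {κ : Cardinal.{u} | ∃ B : Set (Set X), TopologicalSpace.IsTopologicalBasis B ∧ #B = κ})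

/-- A map is skeletal if the closure of the image of each nonempty open set has nonempty
interior. -/
def IsSkeletalMap {X Y : Type*} [TopologicalSpace X] [TopologicalSpace Y] (f : X → Y) : Prop :=
  ∀ U : Set X, IsOpen U → U.Nonempty → (interior (closure (f '' U))).Nonempty

/-- A surjection is irreducible if no proper closed subset of the domain is mapped onto the
codomain. -/
def IsIrreducibleMap {X Y : Type*} [TopologicalSpace X] (f : X → Y) : Prop :=
  Function.Surjective f ∧ ∀ F : Set X, IsClosed F → f '' F = Set.univ → F = Set.univ

/-- `θ : Z → X` exhibits `Z` as the absolute of `X`: `Z` is an extremally disconnected Tychonoff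
space and `θ` is a perfect irreducible map onto `X`. Perfect maps (continuous closed maps with
compact fibers) are Mathlib's `IsProperMap`, see
`isProperMap_iff_isClosedMap_and_compact_fibers`. -/
structure IsAbsolute {Z X : Type*} [TopologicalSpace Z] [TopologicalSpace X] (θ : Z → X) :
    Prop where
  tychonoff : T35Space Z
  extremallyDisconnected : ExtremallyDisconnected Z
  perfect : IsProperMap θ
  irreducible : IsIrreducibleMap θ

/-- `X` and `Y` are co-absolute if they have a common absolute. -/
def CoAbsolute (X Y : Type u) [TopologicalSpace X] [TopologicalSpace Y] : Prop :=
  ∃ (Z : Type u) (_ : TopologicalSpace Z) (θX : Z → X) (θY : Z → Y),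
    IsAbsolute θX ∧ IsAbsolute θY

/-- A Lindelöf p-space: a space admitting a perfect map onto a separable metric space. -/
def IsLindelofPSpace (Y : Type u) [TopologicalSpace Y] : Prop :=
  ∃ (M : Type u) (_ : MetricSpace M) (_ : TopologicalSpace.SeparableSpace M) (f : Y → M),
    IsProperMap f ∧ Function.Surjective f

/-- A map with domain `X`, regarded as a continuous surjection of `X` onto its (Tychonoff)
image. -/
structure MapFrom (X : Type u) [TopologicalSpace X] where
  /-- The image of the map. -/
  Image : Type u
  [top : TopologicalSpace Image]
  [tychonoff : T35Space Image]
  /-- The underlying function. -/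
  toFun : X → Image
  continuous_toFun : Continuous toFun
  surjective_toFun : Function.Surjective toFun

attribute [instance] MapFrom.top MapFrom.tychonoff

namespace MapFrom

variable {X : Type u} [TopologicalSpace X]

/-- `φ ≺ f`: there is a continuous `g` with `f = g ∘ φ`. -/
def Prec (φ f : MapFrom X) : Prop :=
  ∃ g : φ.Image → f.Image, Continuous g ∧ f.toFun = g ∘ φ.toFun

/-- Two maps onto their images are identified when they differ by a homeomorphism of the
images. -/
def Equivalent (φ ψ : MapFrom X) : Prop :=
  ∃ h : φ.Image ≃ₜ ψ.Image, ψ.toFun = h ∘ φ.toFun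

/-- The diagonal product of a family of maps, as a map onto its image in the product of the
images of the members. -/
def diagonal {A : Type u} (φ : A → MapFrom X) : MapFrom X where
  Image := Set.range fun (x : X) (a : A) => (φ a).toFun x
  toFun := Set.rangeFactorization fun (x : X) (a : A) => (φ a).toFun x
  continuous_toFun :=
    (continuous_pi fun a => (φ a).continuous_toFun).subtype_mk _
  surjective_toFun := Set.rangeFactorization_surjective

end MapFrom

/-- `Ψ` is a multiplicative lattice on `X`: every map `f` on `X` is refined by a member of `Ψ`
whose image has weight at most that of the image of `f`, and the diagonal product of every
nonempty family of members of `Ψ` belongs to `Ψ` (up to a homeomorphism of the images). -/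
structure IsMultiplicativeLattice {X : Type u} [TopologicalSpace X] (Ψ : Set (MapFrom X)) :
    Prop where
  exists_prec : ∀ f : MapFrom X, ∃ φ ∈ Ψ, φ.Prec f ∧ weight φ.Image ≤ weight f.Image
  diagonal_mem : ∀ (A : Type u) [Nonempty A] (φ : A → MapFrom X), (∀ a, φ a ∈ Ψ) →
    ∃ ψ ∈ Ψ, ψ.Equivalent (MapFrom.diagonal φ)

/-- `X` has a multiplicative lattice of open maps. -/
def HasLatticeOfOpenMaps (X : Type u) [TopologicalSpace X] : Prop :=
  ∃ Ψ : Set (MapFrom X), IsMultiplicativeLattice Ψ ∧ ∀ φ ∈ Ψ, IsOpenMap φ.toFun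

/-- `X` has a multiplicative lattice of perfect skeletal maps. -/
def HasLatticeOfPerfectSkeletalMaps (X : Type u) [TopologicalSpace X] : Prop :=
  ∃ Ψ : Set (MapFrom X), IsMultiplicativeLattice Ψ ∧
    ∀ φ ∈ Ψ, IsProperMap φ.toFun ∧ IsSkeletalMap φ.toFun

end SkeletalLattice

/-! Let `θ : Z → Y` and `η : Z → X` be the maps from a common absolute. Open sets of `Y` and of `X`
are compared through the closures of their preimages in `Z`. Call `f` on `Y` and `φ` on `X` matched
if each open set pulled back along one corresponds in this way to an open set pulled back along the
other. The lattice on `Y` consists of the maps that refine the given perfect map `p` onto a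
separable metric space and are matched with a member of `Ψ`.

Such an `f` is perfect because it is a factor of `p`, and skeletal because it is matched with an
open map (`isSkeletalMap_of_matched`). Diagonal products preserve matching because the sets that can
be matched form a topology (`matched`). Refinements come from a back-and-forth of length ω. Its
weight stays under control because open maps force the countable chain condition on `X`, hence on
`Z`, so each open set of `Z` is matched through a map of countable weight
(`exists_pullback_closure_eq`). -/

namespace SkeletalLattice

open TopologicalSpace

/-! ### Weight estimates. -/

section Weight

theorem aleph0_le_weight (X : Type u) [TopologicalSpace X] : ℵ₀ ≤ weight X :=
  le_max_left _ _

theorem exists_basis_card_le_weight (X : Type u) [TopologicalSpace X] :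
    ∃ B : Set (Set X), IsTopologicalBasis B ∧ #B ≤ weight X := by
  have hne : {κ : Cardinal.{u} | ∃ B : Set (Set X), IsTopologicalBasis B ∧ #B = κ}.Nonempty :=
    ⟨_, {U : Set X | IsOpen U}, isTopologicalBasis_opens, rfl⟩
  obtain ⟨B, hB, hc⟩ := csInf_mem hne
  exact ⟨B, hB, hc.le.trans (le_max_right _ _)⟩

theorem weight_le_of_isTopologicalBasis {X : Type u} [TopologicalSpace X] {B : Set (Set X)}
    (hB : IsTopologicalBasis B) {κ : Cardinal.{u}} (hκ : ℵ₀ ≤ κ) (hc : #B ≤ κ) :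
    weight X ≤ κ :=
  have hmem : #B ∈ {κ : Cardinal.{u} | ∃ B : Set (Set X), IsTopologicalBasis B ∧ #B = κ} :=
    ⟨B, hB, rfl⟩
  max_le hκ ((csInf_le' hmem).trans hc)

theorem weight_le_of_eq_generateFrom {X : Type u} [t : TopologicalSpace X] {S : Set (Set X)}
    (hS : t = generateFrom S) {κ : Cardinal.{u}} (hκ : ℵ₀ ≤ κ) (hc : #S ≤ κ) :
    weight X ≤ κ := by
  refine weight_le_of_isTopologicalBasis (isTopologicalBasis_of_subbasis hS) hκ ?_
  have hsub : ((fun f => ⋂₀ f) '' {f : Set (Set X) | f.Finite ∧ f ⊆ S}) ⊆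
      Set.range fun F : Finset S => ⋂₀ (Subtype.val '' (F : Set S)) := by
    rintro _ ⟨f, ⟨hf, hfS⟩, rfl⟩
    lift f to Set S using hfS
    have hf' : f.Finite := hf.of_finite_image Subtype.val_injective.injOn
    exact ⟨hf'.toFinset, by simp⟩
  refine (mk_le_mk_of_subset hsub).trans (mk_range_le.trans ?_)
  rcases finite_or_infinite S with h | h
  · exact (mk_le_aleph0 (α := Finset S)).trans hκ
  · rwa [mk_finset_of_infinite]

theorem weight_le_aleph0 (X : Type u) [TopologicalSpace X] [SecondCountableTopology X] :
    weight X ≤ ℵ₀ :=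
  weight_le_of_isTopologicalBasis (isBasis_countableBasis X) le_rfl
    (le_aleph0_iff_set_countable.2 (countable_countableBasis X))

theorem secondCountableTopology_of_weight_le {X : Type u} [TopologicalSpace X]
    (h : weight X ≤ ℵ₀) : SecondCountableTopology X := by
  obtain ⟨B, hB, hc⟩ := exists_basis_card_le_weight X
  exact hB.secondCountableTopology (le_aleph0_iff_set_countable.1 (hc.trans h))

end Weight

/-! ### Maps on a space as coarser topologies. -/

namespace MapFrom

variable {X : Type u} [TopologicalSpace X]

/-- The topology on the domain whose open sets are the preimages of open sets of the image. -/
@[reducible]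
def pullback (f : MapFrom X) : TopologicalSpace X :=
  f.top.induced f.toFun

theorem isOpen_of_pullback (f : MapFrom X) {V : Set X} (h : IsOpen[f.pullback] V) : IsOpen V :=
  f.continuous_toFun.le_induced V h

theorem mem_of_pullback (f : MapFrom X) {V : Set X} (h : IsOpen[f.pullback] V) {x y : X}
    (hxy : f.toFun x = f.toFun y) (hx : x ∈ V) : y ∈ V := by
  obtain ⟨G, -, rfl⟩ := h
  simpa [← hxy] using hx

theorem Prec.pullback_le {f g : MapFrom X} (h : f.Prec g) : f.pullback ≤ g.pullback := by
  obtain ⟨k, hk, e⟩ := h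
  rw [pullback, pullback, e, ← induced_compose]
  exact induced_mono hk.le_induced

theorem Prec.trans {f g k : MapFrom X} (h : f.Prec g) (h' : g.Prec k) : f.Prec k := by
  obtain ⟨a, ha, e⟩ := h
  obtain ⟨b, hb, e'⟩ := h'
  exact ⟨b ∘ a, hb.comp ha, by rw [e', e, Function.comp_assoc]⟩

theorem Equivalent.refl (f : MapFrom X) : f.Equivalent f :=
  ⟨Homeomorph.refl _, rfl⟩

theorem Equivalent.pullback_eq {f g : MapFrom X} (h : f.Equivalent g) :
    f.pullback = g.pullback := by
  obtain ⟨k, e⟩ := h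
  rw [pullback, pullback, e, ← induced_compose, ← k.isInducing.eq_induced]

theorem diagonal_prec {A : Type u} (f : A → MapFrom X) (a : A) : (diagonal f).Prec (f a) :=
  ⟨fun y => y.1 a, (continuous_apply a).comp continuous_subtype_val, rfl⟩

theorem diagonal_top_eq {A : Type u} (f : A → MapFrom X) :
    (diagonal f).top = ⨅ a, (f a).top.induced (fun y : (diagonal f).Image => y.1 a) := by
  change TopologicalSpace.induced Subtype.val 
    (⨅ a, (f a).top.induced (fun y : (∀ b, (f b).Image) => y a)) = _
  rw [induced_iInf]
  simp only [induced_compose]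
  rfl

/-- Turns statements about diagonal products into lattice inequalities between topologies. -/
theorem pullback_diagonal {A : Type u} (f : A → MapFrom X) :
    (diagonal f).pullback = ⨅ a, (f a).pullback := by
  rw [pullback, diagonal_top_eq, induced_iInf]
  simp only [induced_compose]
  rfl

theorem weight_diagonal_le {A : Type u} (f : A → MapFrom X) {κ : Cardinal.{u}} (hκ : ℵ₀ ≤ κ)
    (hA : #A ≤ κ) (hf : ∀ a, weight (f a).Image ≤ κ) : weight (diagonal f).Image ≤ κ := by
  choose B hB hc using fun a => exists_basis_card_le_weight (f a).Image
  refine weight_le_of_eq_generateFrom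
    (S := ⋃ a, Set.preimage (fun y : (diagonal f).Image => y.1 a) '' B a) ?_ hκ ?_
  · rw [generateFrom_iUnion, diagonal_top_eq]
    refine iInf_congr fun a => ?_
    rw [← induced_generateFrom_eq, ← (hB a).eq_generateFrom]
  · refine (mk_iUnion_le_sum_mk.trans (sum_le_sum _ (fun _ => κ)
      fun a => mk_image_le.trans ((hc a).trans (hf a)))).trans ?_
    rw [sum_const']
    exact (mul_le_mul_left hA _).trans (mul_eq_self hκ).le

end MapFrom

/-! ### The countable chain condition from open maps, and its transfer to the absolute. -/

section CountableChainCondition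

open MapFrom

/-- Every family of open sets has a countable subfamily with dense union; an equivalent form of
the countable chain condition. -/
def HasCountableDenseSubfamilies (Z : Type*) [TopologicalSpace Z] : Prop :=
  ∀ C : Set (Set Z), (∀ O ∈ C, IsOpen O) →
    ∃ D ⊆ C, D.Countable ∧ ⋃₀ C ⊆ closure (⋃₀ D)

variable {X Y Z : Type u} [TopologicalSpace X] [TopologicalSpace Y] [TopologicalSpace Z]

theorem exists_isOpen_pullback_subset [T35Space X] {U : Set X} (hU : IsOpen U) {x : X}
    (hx : x ∈ U) :
    ∃ f : MapFrom X, weight f.Image ≤ ℵ₀ ∧ ∃ V, IsOpen[f.pullback] V ∧ x ∈ V ∧ V ⊆ U := by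
  obtain ⟨g, hg, hgx, hgU⟩ := CompletelyRegularSpace.completely_regular x Uᶜ hU.isClosed_compl
    (by simpa using hx)
  let k : X → ULift.{u} ℝ := fun y => ULift.up (g y : ℝ)
  have hk : Continuous k := continuous_uliftUp.comp (continuous_subtype_val.comp hg)
  have : SecondCountableTopology (ULift.{u} ℝ) :=
    Homeomorph.ulift.isInducing.secondCountableTopology
  have : T35Space (ULift.{u} ℝ) := Homeomorph.ulift.isEmbedding.t35Space
  let f : MapFrom X :=
    { Image := Set.range k
      toFun := Set.rangeFactorization k
      continuous_toFun := hk.subtype_mk _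
      surjective_toFun := Set.rangeFactorization_surjective }
  refine ⟨f, weight_le_aleph0 (Set.range k), f.toFun ⁻¹' {y | y.1.down < 1},
    ⟨_, isOpen_lt (continuous_uliftDown.comp continuous_subtype_val) continuous_const, rfl⟩,
    ?_, ?_⟩
  · change (g x : ℝ) < 1
    simp [hgx]
  · intro y hy
    by_contra hyU
    have h1 : (g y : ℝ) < 1 := hy
    simp [hgU hyU] at h1

/-- A closing-off argument: `f` is the limit of maps `φ n` in `Ψ` such that every `φ n`-open set
meeting `⋃₀ C` meets a `φ (n + 1)`-open member of `C`. Openness of the limit then yields density in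
the full topology of `X`. -/
theorem exists_map_dense_sUnion_pullback {Ψ : Set (MapFrom X)} (hΨ : IsMultiplicativeLattice Ψ)
    (hopen : ∀ φ ∈ Ψ, IsOpenMap φ.toFun) {C : Set (Set X)}
    (hC : ∀ V ∈ C, ∃ f : MapFrom X, weight f.Image ≤ ℵ₀ ∧ IsOpen[f.pullback] V) :
    ∃ f : MapFrom X, weight f.Image ≤ ℵ₀ ∧
      ⋃₀ C ⊆ closure (⋃₀ {V ∈ C | IsOpen[f.pullback] V}) := by
  have step : ∀ φ : MapFrom X, weight φ.Image ≤ ℵ₀ → ∃ φ' : MapFrom X,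
      (φ' ∈ Ψ ∧ weight φ'.Image ≤ ℵ₀) ∧ φ'.pullback ≤ φ.pullback ∧
      ∀ U, IsOpen[φ.pullback] U → (U ∩ ⋃₀ C).Nonempty →
        ∃ V ∈ C, IsOpen[φ'.pullback] V ∧ (U ∩ V).Nonempty := by
    intro φ hφ
    obtain ⟨B, hB, hc⟩ := exists_basis_card_le_weight φ.Image
    let B' : Set (Set φ.Image) := {G ∈ B | (φ.toFun ⁻¹' G ∩ ⋃₀ C).Nonempty}
    have hsel : ∀ G : B', ∃ V ∈ C, (φ.toFun ⁻¹' G.1 ∩ V).Nonempty := by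
      rintro ⟨G, -, x, hx, V, hV, hxV⟩
      exact ⟨V, hV, x, hx, hxV⟩
    choose V hVC hV using hsel
    choose f hf hfV using fun G => hC (V G) (hVC G)
    let F : Option B' → MapFrom X := fun o => o.elim φ f
    have hFw : weight (diagonal F).Image ≤ ℵ₀ := by
      have hB'c : #B' ≤ ℵ₀ :=
        (mk_le_mk_of_subset (Set.sep_subset _ _)).trans (hc.trans hφ)
      have : Countable B' := mk_le_aleph0_iff.1 hB'c
      refine weight_diagonal_le F le_rfl mk_le_aleph0 ?_
      rintro (_ | G)
      exacts [hφ, hf G]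
    obtain ⟨φ', hφ', hprec, hw⟩ := hΨ.exists_prec (diagonal F)
    have hle : ∀ o, φ'.pullback ≤ (F o).pullback := fun o =>
      (hprec.trans (diagonal_prec F o)).pullback_le
    refine ⟨φ', ⟨hφ', hw.trans hFw⟩, hle none, ?_⟩
    rintro _ ⟨G, hG, rfl⟩ ⟨x, hxG, hxC⟩
    obtain ⟨G', hG'B, hxG', hG'G⟩ := hB.exists_subset_of_mem_open hxG hG
    let i : B' := ⟨G', hG'B, x, hxG', hxC⟩
    obtain ⟨y, hy, hyV⟩ := hV i
    exact ⟨V i, hVC i, hle (some i) _ (hfV i), y, hG'G hy, hyV⟩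
  choose! next hnext hnext_le hnext_meets using step
  let start : MapFrom X := diagonal (A := PEmpty.{u + 1}) fun a => a.elim
  have hstart : weight start.Image ≤ ℵ₀ :=
    weight_diagonal_le _ le_rfl mk_le_aleph0 fun a => a.elim
  -- The shift by one puts even `φ 0` in `Ψ`; `start` itself need not lie there.
  let φ : ℕ → MapFrom X := fun n => next^[n + 1] start
  have hsucc : ∀ n, φ (n + 1) = next (φ n) := fun n => Function.iterate_succ_apply' _ _ _
  have hφ : ∀ n, φ n ∈ Ψ ∧ weight (φ n).Image ≤ ℵ₀ := by
    intro n
    induction n with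
    | zero => exact hnext _ hstart
    | succ n ih => rw [hsucc]; exact hnext _ ih.2
  have hanti : Antitone fun n => (φ n).pullback := by
    refine antitone_nat_of_succ_le fun n => ?_
    rw [hsucc]
    exact hnext_le _ (hφ n).2
  let f := diagonal fun n : ULift.{u} ℕ => φ n.down
  have hpull : f.pullback = ⨅ n : ULift.{u} ℕ, (φ n.down).pullback := pullback_diagonal _
  have hfle : ∀ n, f.pullback ≤ (φ n).pullback := fun n =>
    (diagonal_prec (fun n : ULift.{u} ℕ => φ n.down) ⟨n⟩).pullback_le
  obtain ⟨ψ, hψ, hψf⟩ := hΨ.diagonal_mem (ULift.{u} ℕ) (fun n => φ n.down) fun n => (hφ _).1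
  have hψpull : ψ.pullback = f.pullback := hψf.pullback_eq
  refine ⟨f, weight_diagonal_le _ le_rfl mk_le_aleph0 fun n => (hφ _).2, ?_⟩
  rintro x ⟨V, hV, hxV⟩
  rw [mem_closure_iff]
  intro U₀ hU₀ hxU₀
  obtain ⟨fV, -, hfV⟩ := hC V hV
  have hUV : IsOpen (U₀ ∩ V) := hU₀.inter (fV.isOpen_of_pullback hfV)
  -- Here the openness of members of `Ψ` enters: the saturation of `U₀ ∩ V` is `f`-open, so it
  -- contains a `φ n`-neighbourhood of `x` for some `n`.
  have hsat : IsOpen[f.pullback] (ψ.toFun ⁻¹' (ψ.toFun '' (U₀ ∩ V))) := by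
    rw [← hψpull]
    exact ⟨_, hopen ψ hψ _ hUV, rfl⟩
  have hnhds : ψ.toFun ⁻¹' (ψ.toFun '' (U₀ ∩ V)) ∈ @nhds X f.pullback x :=
    @IsOpen.mem_nhds X f.pullback x _ hsat ⟨x, ⟨hxU₀, hxV⟩, rfl⟩
  have hdir : Directed (· ≥ ·) fun n : ULift.{u} ℕ => @nhds X (φ n.down).pullback x := by
    intro a b
    refine ⟨⟨max a.down b.down⟩, ?_, ?_⟩
    · exact nhds_mono (hanti (le_max_left _ _))
    · exact nhds_mono (hanti (le_max_right _ _))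
  rw [hpull, nhds_iInf, Filter.mem_iInf_of_directed hdir] at hnhds
  obtain ⟨n, hn⟩ := hnhds
  obtain ⟨U, hUsub, hU, hxU⟩ := (@mem_nhds_iff X (φ n.down).pullback x _).1 hn
  obtain ⟨V', hV'C, hV', z, hzU, hzV'⟩ := hnext_meets (φ n.down) (hφ _).2 U hU
    ⟨x, hxU, V, hV, hxV⟩
  rw [← hsucc] at hV'
  have hV'f : IsOpen[f.pullback] V' := hfle _ _ hV'
  -- `z` is only in the saturation; since `V'` is saturated, it also contains a point `z'` of `U₀`
  -- in the same fiber.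
  obtain ⟨z', ⟨hz'U, -⟩, hz'⟩ := hUsub hzU
  refine ⟨z', hz'U, V', ⟨hV'C, hV'f⟩, ?_⟩
  rw [← hψpull] at hV'f
  exact ψ.mem_of_pullback hV'f hz'.symm hzV'

theorem HasLatticeOfOpenMaps.exists_countable_dense (hX : HasLatticeOfOpenMaps X)
    {C : Set (Set X)}
    (hC : ∀ V ∈ C, ∃ f : MapFrom X, weight f.Image ≤ ℵ₀ ∧ IsOpen[f.pullback] V) :
    ∃ D ⊆ C, D.Countable ∧ ⋃₀ C ⊆ closure (⋃₀ D) := by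
  obtain ⟨Ψ, hΨ, hopen⟩ := hX
  obtain ⟨f, hf, hd⟩ := exists_map_dense_sUnion_pullback hΨ hopen hC
  have := secondCountableTopology_of_weight_le hf
  have hsc : @SecondCountableTopology X f.pullback :=
    secondCountableTopology_induced X f.Image f.toFun
  obtain ⟨D, hDc, hDsub, hDU⟩ := @isOpen_sUnion_countable X f.pullback hsc
    {V ∈ C | IsOpen[f.pullback] V} fun V hV => hV.2
  exact ⟨D, hDsub.trans (Set.sep_subset _ _), hDc, hDU ▸ hd⟩

theorem IsIrreducibleMap.exists_preimage_subset {θ : Z → X} (hθ : IsIrreducibleMap θ)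
    (hcl : IsClosedMap θ) {O : Set Z} (hO : IsOpen O) (hne : O.Nonempty) :
    ∃ W : Set X, IsOpen W ∧ W.Nonempty ∧ θ ⁻¹' W ⊆ O := by
  refine ⟨(θ '' Oᶜ)ᶜ, (hcl _ hO.isClosed_compl).isOpen_compl, ?_, ?_⟩
  · rw [Set.nonempty_compl]
    intro h
    have := hθ.2 _ hO.isClosed_compl h
    simp_all
  · intro z hz
    by_contra h
    exact hz ⟨z, h, rfl⟩

theorem IsIrreducibleMap.exists_pullback_preimage_subset [T35Space X] {θ : Z → X}
    (hθ : IsIrreducibleMap θ) (hcl : IsClosedMap θ) {O : Set Z} (hO : IsOpen O)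
    (hne : O.Nonempty) :
    ∃ W : Set X, W.Nonempty ∧ θ ⁻¹' W ⊆ O ∧
      ∃ f : MapFrom X, weight f.Image ≤ ℵ₀ ∧ IsOpen[f.pullback] W := by
  obtain ⟨W, hW, ⟨x, hx⟩, hWO⟩ := hθ.exists_preimage_subset hcl hO hne
  obtain ⟨f, hf, V, hV, hxV, hVW⟩ := exists_isOpen_pullback_subset hW hx
  exact ⟨V, ⟨x, hxV⟩, (Set.preimage_mono hVW).trans hWO, f, hf, hV⟩

/-- Apply the result on `X` to the sets whose preimages lie inside members of `C`. If the chosen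
members of `C` missed part of `⋃₀ C`, irreducibility would fit another such preimage into the gap.
-/
theorem HasLatticeOfOpenMaps.hasCountableDenseSubfamilies [T35Space X]
    (hX : HasLatticeOfOpenMaps X) {θ : Z → X} (hθ : IsIrreducibleMap θ)
    (hcl : IsClosedMap θ) : HasCountableDenseSubfamilies Z := by
  intro C hC
  let C' : Set (Set X) := {W | (∃ O ∈ C, θ ⁻¹' W ⊆ O) ∧
    ∃ f : MapFrom X, weight f.Image ≤ ℵ₀ ∧ IsOpen[f.pullback] W}
  obtain ⟨D, hDC', hDc, hD⟩ := hX.exists_countable_dense (C := C') fun W hW => hW.2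
  choose! O hOC hO using fun W (hW : W ∈ D) => (hDC' hW).1
  refine ⟨O '' D, Set.image_subset_iff.2 hOC, hDc.image O, ?_⟩
  rintro z ⟨P, hP, hzP⟩
  by_contra hz
  obtain ⟨W, ⟨x, hx⟩, hWsub, f, hf, hW⟩ := hθ.exists_pullback_preimage_subset hcl
    ((hC P hP).sdiff isClosed_closure) ⟨z, hzP, hz⟩
  have hWC' : W ∈ C' := ⟨⟨P, hP, hWsub.trans Set.sdiff_subset⟩, f, hf, hW⟩
  obtain ⟨y, hyW, V, hV, hyV⟩ := mem_closure_iff.1 (hD ⟨W, hWC', hx⟩) W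
    (f.isOpen_of_pullback hW) hx
  obtain ⟨t, rfl⟩ := hθ.1 y
  exact (hWsub hyW).2 (subset_closure ⟨O V, ⟨V, hV, rfl⟩, hO V hV hyV⟩)

/-- By irreducibility the preimages lying inside `O` have dense union in `O`; countably many
suffice, and one countable diagonal product makes them all open. -/
theorem HasCountableDenseSubfamilies.exists_pullback_closure_eq [T35Space X]
    (hZ : HasCountableDenseSubfamilies Z) {θ : Z → X} (hθ : IsIrreducibleMap θ)
    (hcont : Continuous θ) (hcl : IsClosedMap θ) {O : Set Z} (hO : IsOpen O) :
    ∃ f : MapFrom X, weight f.Image ≤ ℵ₀ ∧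
      ∃ W, IsOpen[f.pullback] W ∧ closure O = closure (θ ⁻¹' W) := by
  let C : Set (Set X) := {W | θ ⁻¹' W ⊆ O ∧
    ∃ f : MapFrom X, weight f.Image ≤ ℵ₀ ∧ IsOpen[f.pullback] W}
  obtain ⟨D', hD'C, hD'c, hD'⟩ := hZ (Set.preimage θ '' C) (by
    rintro _ ⟨W, ⟨-, f, -, hW⟩, rfl⟩
    exact (f.isOpen_of_pullback hW).preimage hcont)
  obtain ⟨D, hDC, hDc, rfl⟩ : ∃ D ⊆ C, D.Countable ∧ Set.preimage θ '' D = D' := by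
    choose! W hWC hW using hD'C
    refine ⟨W '' D', Set.image_subset_iff.2 hWC, hD'c.image W, ?_⟩
    rw [Set.image_image, Set.image_congr hW, Set.image_id']
  choose f hf hfW using fun W : D => (hDC W.2).2
  have := hDc.to_subtype
  refine ⟨diagonal f, weight_diagonal_le f le_rfl mk_le_aleph0 hf, ⋃₀ D, ?_, ?_⟩
  · refine @isOpen_sUnion X (diagonal f).pullback _ fun W hW => ?_
    exact (diagonal_prec f ⟨W, hW⟩).pullback_le W (hfW ⟨W, hW⟩)
  · refine subset_antisymm (closure_minimal (fun z hz => ?_) isClosed_closure)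
      (closure_mono ?_)
    · by_contra hn
      obtain ⟨W, ⟨x, hx⟩, hWsub, g, hg, hW⟩ := hθ.exists_pullback_preimage_subset hcl
        (hO.sdiff isClosed_closure) ⟨z, hz, hn⟩
      obtain ⟨t, rfl⟩ := hθ.1 x
      refine (hWsub hx).2 ?_
      rw [Set.preimage_sUnion, ← Set.sUnion_image]
      exact hD' ⟨_, ⟨W, ⟨hWsub.trans Set.sdiff_subset, g, hg, hW⟩, rfl⟩, hx⟩
    · rintro z ⟨W, hW, hzW⟩
      exact (hDC hW).1 hzW

end CountableChainCondition

/-! ### Matching maps on two spaces through a common preimage. -/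

section Matching

open MapFrom

variable {X Y Z : Type u} [TopologicalSpace Z]

theorem closure_inter_eq_of_closure_eq {A B C D : Set Z} (hB : IsOpen B) (hC : IsOpen C)
    (hA : IsOpen A) (hD : IsOpen D) (hAB : closure A = closure B)
    (hCD : closure C = closure D) : closure (A ∩ C) = closure (B ∩ D) := by
  have key : ∀ {A B C D : Set Z}, IsOpen A → IsOpen D → closure A = closure B →
      closure C = closure D → closure (A ∩ C) ⊆ closure (B ∩ D) := by
    intro A B C D hA hD hAB hCD
    have h1 : A ∩ C ⊆ closure (A ∩ D) := fun z hz =>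
      hA.inter_closure ⟨hz.1, hCD ▸ subset_closure hz.2⟩
    have h2 : A ∩ D ⊆ closure (B ∩ D) := fun z hz =>
      hD.closure_inter ⟨hAB ▸ subset_closure hz.1, hz.2⟩
    exact closure_minimal (h1.trans (closure_minimal h2 isClosed_closure)) isClosed_closure
  exact (key hA hD hAB hCD).antisymm (key hB hC hAB.symm hCD.symm)

theorem closure_iUnion_congr {ι : Sort*} {A B : ι → Set Z}
    (h : ∀ i, closure (A i) = closure (B i)) : closure (⋃ i, A i) = closure (⋃ i, B i) := by
  have key : ∀ {A B : ι → Set Z}, (∀ i, closure (A i) = closure (B i)) →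
      closure (⋃ i, A i) ⊆ closure (⋃ i, B i) := fun {A B} h =>
    closure_minimal (Set.iUnion_subset fun i => subset_closure.trans
      ((h i).le.trans (closure_mono (Set.subset_iUnion B i)))) isClosed_closure
  exact (key h).antisymm (key fun i => (h i).symm)

/-- The topology of all `V ⊆ Y` with open preimage under `θ` in `Z`, such that this preimage has
the same closure as the (open) preimage under `η` of some open set of `t`. -/
@[reducible]
def matched (θ : Z → Y) (η : Z → X) (t : TopologicalSpace X) : TopologicalSpace Y where
  IsOpen V := IsOpen (θ ⁻¹' V) ∧
    ∃ W, IsOpen (η ⁻¹' W) ∧ IsOpen[t] W ∧ closure (θ ⁻¹' V) = closure (η ⁻¹' W)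
  isOpen_univ := ⟨isOpen_univ, Set.univ, isOpen_univ, @isOpen_univ X t, by simp⟩
  isOpen_inter := by
    rintro V V' ⟨hV, W, hW, hWt, h⟩ ⟨hV', W', hW', hWt', h'⟩
    refine ⟨hV.inter hV', W ∩ W', hW.inter hW', hWt.inter hWt', ?_⟩
    exact closure_inter_eq_of_closure_eq hW hV' hV hW' h h'
  isOpen_sUnion := by
    intro S hS
    choose W hW hWt h using fun V : S => (hS V.1 V.2).2
    refine ⟨?_, ⋃ V, W V, ?_, isOpen_iUnion hWt, ?_⟩
    · rw [Set.preimage_sUnion]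
      exact isOpen_biUnion fun V hV => (hS V hV).1
    · rw [Set.preimage_iUnion]
      exact isOpen_iUnion hW
    · rw [Set.sUnion_eq_iUnion, Set.preimage_iUnion, Set.preimage_iUnion]
      exact closure_iUnion_congr h

theorem matched_mono (θ : Z → Y) (η : Z → X) {t t' : TopologicalSpace X} (h : t ≤ t') :
    matched θ η t ≤ matched θ η t' := by
  rintro V ⟨hV, W, hW, hWt, e⟩
  exact ⟨hV, W, hW, h W hWt, e⟩

theorem matched_le_pullback_diagonal [TopologicalSpace Y] {θ : Z → Y} {η : Z → X} {A : Type u} {f : A → MapFrom Y}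
    {t : TopologicalSpace X} (h : ∀ a, matched θ η t ≤ (f a).pullback) :
    matched θ η t ≤ (diagonal f).pullback := by
  rw [pullback_diagonal]
  exact le_iInf h

variable [TopologicalSpace X] [TopologicalSpace Y]

/-- Each member of a base costs only a map of countable weight, so their diagonal product does not
exceed the weight of `f.Image`. -/
theorem HasCountableDenseSubfamilies.exists_matched_le [T35Space X]
    (hZ : HasCountableDenseSubfamilies Z) {θ : Z → Y} {η : Z → X} (hθ : Continuous θ)
    (hη : IsIrreducibleMap η) (hcont : Continuous η) (hcl : IsClosedMap η) (f : MapFrom Y) :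
    ∃ g : MapFrom X, weight g.Image ≤ weight f.Image ∧ matched θ η g.pullback ≤ f.pullback := by
  obtain ⟨B, hB, hc⟩ := exists_basis_card_le_weight f.Image
  have hV : ∀ G : B, IsOpen (θ ⁻¹' (f.toFun ⁻¹' G.1)) := fun G =>
    ((hB.isOpen G.2).preimage f.continuous_toFun).preimage hθ
  choose g hg W hW hcw using fun G : B => hZ.exists_pullback_closure_eq hη hcont hcl (hV G)
  refine ⟨diagonal g, weight_diagonal_le g (aleph0_le_weight _) hc
    fun G => (hg G).trans (aleph0_le_weight _), ?_⟩
  have hf : f.pullback = generateFrom (Set.preimage f.toFun '' B) := by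
    rw [← induced_generateFrom_eq, ← hB.eq_generateFrom]
  rw [hf, le_generateFrom_iff_subset_isOpen]
  rintro _ ⟨G, hG, rfl⟩
  exact ⟨hV ⟨G, hG⟩, W ⟨G, hG⟩, ((g _).isOpen_of_pullback (hW _)).preimage hcont,
    (diagonal_prec g ⟨G, hG⟩).pullback_le _ (hW _), hcw ⟨G, hG⟩⟩

theorem disjoint_of_disjoint_of_closure_eq {A B C D : Set Z} (hA : IsOpen A) (hB : IsOpen B)
    (hC : IsOpen C) (hD : IsOpen D) (hAB : closure A = closure B) (hCD : closure C = closure D)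
    (h : Disjoint A C) : Disjoint B D := by
  have := closure_inter_eq_of_closure_eq hB hC hA hD hAB hCD
  rw [Set.disjoint_iff_inter_eq_empty] at h ⊢
  rwa [h, closure_empty, eq_comm, closure_empty_iff] at this

/-- A map matched with an open map is skeletal. -/
theorem isSkeletalMap_of_matched {θ : Z → Y} {η : Z → X} (hθ : Function.Surjective θ)
    (hθc : Continuous θ) (hη : IsIrreducibleMap η) (hcont : Continuous η) (hcl : IsClosedMap η)
    {f : MapFrom Y} {φ : MapFrom X} (hφ : IsOpenMap φ.toFun)
    (hfφ : matched θ η φ.pullback ≤ f.pullback)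
    (hφf : matched η θ f.pullback ≤ φ.pullback) : IsSkeletalMap f.toFun := by
  intro U hU hUne
  obtain ⟨W, hW, ⟨w, hw⟩, hWU⟩ := hη.exists_preimage_subset hcl (hU.preimage hθc)
    (hUne.preimage hθ)
  -- `V` is the partner of the open set `φ(W)`; it is the interior witness.
  obtain ⟨hP, _, hfV, ⟨V, hV, rfl⟩, hPV⟩ := hφf _ ⟨_, hφ W hW, rfl⟩
  obtain ⟨t, rfl⟩ := hη.1 w
  have hsub : V ⊆ closure (f.toFun '' U) := by
    intro y hy
    rw [mem_closure_iff]
    intro O hO hyO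
    by_contra hne
    obtain ⟨hQ, _, hφG, ⟨G, hG, rfl⟩, hQG⟩ := hfφ _ ⟨O, hO, rfl⟩
    have hdU : Disjoint (θ ⁻¹' (f.toFun ⁻¹' O)) (η ⁻¹' W) :=
      Set.disjoint_left.2 fun z hz hzW => hne ⟨_, hz, _, hWU hzW, rfl⟩
    have hdW : Disjoint (η ⁻¹' (φ.toFun ⁻¹' G)) (η ⁻¹' W) :=
      disjoint_of_disjoint_of_closure_eq hQ hφG (hW.preimage hcont) (hW.preimage hcont)
        hQG rfl hdU
    -- A `φ`-saturated set that misses `W` misses the saturation of `W`.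
    have hdP : Disjoint (η ⁻¹' (φ.toFun ⁻¹' G))
        (η ⁻¹' (φ.toFun ⁻¹' (φ.toFun '' W))) := by
      rw [Set.disjoint_left]
      rintro z hz ⟨x, hx, hxz⟩
      obtain ⟨z', rfl⟩ := hη.1 x
      refine Set.disjoint_left.1 hdW (?_ : φ.toFun (η z') ∈ G) hx
      rw [hxz]
      exact hz
    have hdV := disjoint_of_disjoint_of_closure_eq hφG hQ hP hfV hQG.symm hPV hdP
    obtain ⟨y', rfl⟩ := f.surjective_toFun y
    obtain ⟨z, rfl⟩ := hθ y'
    exact Set.disjoint_left.1 hdV hyO hy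
  have hVne : V.Nonempty := by
    by_contra h
    rw [Set.not_nonempty_iff_eq_empty] at h
    subst h
    have : η ⁻¹' (φ.toFun ⁻¹' (φ.toFun '' W)) = ∅ := by simpa using hPV
    exact this.subset (⟨η t, hw, rfl⟩ : t ∈ η ⁻¹' (φ.toFun ⁻¹' (φ.toFun '' W)))
  exact hVne.mono (interior_maximal hsub hV)

theorem matched_diagonal_le {θ : Z → Y} {η : Z → X} {A : Type u} {f : A → MapFrom Y}
    {g : A → MapFrom X} (h : ∀ a, matched θ η (g a).pullback ≤ (f a).pullback) :
    matched θ η (diagonal g).pullback ≤ (diagonal f).pullback :=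
  matched_le_pullback_diagonal fun a =>
    (matched_mono θ η (diagonal_prec g a).pullback_le).trans (h a)

/-- The maps on `Y` which refine `p` and are matched with a member of `Ψ`. -/
def matchedRefinements (θ : Z → Y) (η : Z → X) (p : MapFrom Y) (Ψ : Set (MapFrom X)) :
    Set (MapFrom Y) :=
  {f | f.Prec p ∧ ∃ φ ∈ Ψ, matched θ η φ.pullback ≤ f.pullback ∧
    matched η θ f.pullback ≤ φ.pullback}

/-- Refinement is a back-and-forth: `φ` passes from `Y` into `Ψ`, `ψ` returns, and neither raises
the weight. The two interleaved diagonal products are matched. -/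
theorem isMultiplicativeLattice_matchedRefinements [T35Space X] [T35Space Y]
    (hZ : HasCountableDenseSubfamilies Z) {θ : Z → Y} {η : Z → X}
    (hθ : IsIrreducibleMap θ) (hθc : Continuous θ) (hθcl : IsClosedMap θ)
    (hη : IsIrreducibleMap η) (hηc : Continuous η) (hηcl : IsClosedMap η)
    {p : MapFrom Y} (hp : weight p.Image ≤ ℵ₀) {Ψ : Set (MapFrom X)}
    (hΨ : IsMultiplicativeLattice Ψ) :
    IsMultiplicativeLattice (matchedRefinements θ η p Ψ) where
  exists_prec f := by
    have forth : ∀ k : MapFrom Y, ∃ φ ∈ Ψ, weight φ.Image ≤ weight k.Image ∧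
        matched θ η φ.pullback ≤ k.pullback := by
      intro k
      obtain ⟨g, hgw, hg⟩ := hZ.exists_matched_le hθc hη hηc hηcl k
      obtain ⟨φ, hφ, hφg, hφw⟩ := hΨ.exists_prec g
      exact ⟨φ, hφ, hφw.trans hgw, (matched_mono θ η hφg.pullback_le).trans hg⟩
    choose φ hφ hφw hφm using forth
    choose ψ hψw hψm using fun k : MapFrom X => hZ.exists_matched_le hηc hθ hθc hθcl k
    let pair : ULift.{u} Bool → MapFrom Y := fun b => cond b.down f p
    -- Starting below both `f` and `p` makes the limit refine `p`; the countable weight of `p.Image`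
    -- adds nothing.
    let start := diagonal pair
    let k : ℕ → MapFrom Y := fun n => (fun h => ψ (φ h))^[n] start
    have hk : ∀ n, k (n + 1) = ψ (φ (k n)) := fun n => Function.iterate_succ_apply' _ _ _
    have hkw : ∀ n, weight (k n).Image ≤ weight f.Image := by
      intro n
      induction n with
      | zero =>
        refine weight_diagonal_le _ (aleph0_le_weight _)
          (mk_le_aleph0.trans (aleph0_le_weight _)) ?_
        rintro ⟨_ | _⟩
        exacts [hp.trans (aleph0_le_weight _), le_rfl]
      | succ n ih => rw [hk]; exact (hψw _).trans ((hφw _).trans ih)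
    let K := diagonal fun n : ULift.{u} ℕ => k n.down
    have hKstart : K.Prec start := diagonal_prec (fun n : ULift.{u} ℕ => k n.down) ⟨0⟩
    obtain ⟨χ, hχ, hχe⟩ := hΨ.diagonal_mem (ULift.{u} ℕ) (fun n => φ (k n.down))
      fun n => hφ _
    refine ⟨K, ⟨hKstart.trans (diagonal_prec pair ⟨false⟩), χ, hχ, ?_, ?_⟩,
      hKstart.trans (diagonal_prec pair ⟨true⟩),
      weight_diagonal_le _ (aleph0_le_weight _) (mk_le_aleph0.trans (aleph0_le_weight _))
        fun n => hkw _⟩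
    · rw [hχe.pullback_eq]
      exact matched_diagonal_le fun n => hφm _
    · rw [hχe.pullback_eq]
      refine matched_le_pullback_diagonal fun n => ?_
      refine (matched_mono η θ ?_).trans (hψm _)
      rw [← hk]
      exact (diagonal_prec (fun n : ULift.{u} ℕ => k n.down) ⟨n.down + 1⟩).pullback_le
  diagonal_mem A _ f hf := by
    choose hfp φ hφ hφf hfφ using hf
    obtain ⟨χ, hχ, hχe⟩ := hΨ.diagonal_mem A φ hφ
    refine ⟨diagonal f, ⟨(diagonal_prec f (Classical.arbitrary A)).trans (hfp _), χ, hχ, ?_, ?_⟩,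
      Equivalent.refl _⟩
    · rw [hχe.pullback_eq]
      exact matched_diagonal_le hφf
    · rw [hχe.pullback_eq]
      exact matched_diagonal_le hfφ

end Matching

end SkeletalLattice

theorem corollary2p4 {X Y : Type u} [TopologicalSpace X] [T35Space X]
    [TopologicalSpace Y] [T35Space Y]
    (hY : SkeletalLattice.IsLindelofPSpace Y)
    (hX : SkeletalLattice.HasLatticeOfOpenMaps X)
    (hYX : SkeletalLattice.CoAbsolute Y X) :
    SkeletalLattice.HasLatticeOfPerfectSkeletalMaps Y := by
  obtain ⟨M, _, _, q, hq, hqs⟩ := hY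
  obtain ⟨Z, _, θ, η, hθ, hη⟩ := hYX
  have hZ := hX.hasCountableDenseSubfamilies hη.irreducible hη.perfect.isClosedMap
  obtain ⟨Ψ, hΨ, hopen⟩ := hX
  have : SecondCountableTopology M := UniformSpace.secondCountable_of_separable M
  let p : SkeletalLattice.MapFrom Y :=
    { Image := M
      toFun := q
      continuous_toFun := hq.continuous
      surjective_toFun := hqs }
  refine ⟨SkeletalLattice.matchedRefinements θ η p Ψ,
    SkeletalLattice.isMultiplicativeLattice_matchedRefinements hZ hθ.irreducible
      hθ.perfect.continuous hθ.perfect.isClosedMap hη.irreducible hη.perfect.continuous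
      hη.perfect.isClosedMap (SkeletalLattice.weight_le_aleph0 M) hΨ, ?_⟩
  rintro f ⟨⟨g, hg, hfg⟩, φ, hφ, hφf, hfφ⟩
  refine ⟨?_, SkeletalLattice.isSkeletalMap_of_matched hθ.irreducible.1 hθ.perfect.continuous
    hη.irreducible hη.perfect.continuous hη.perfect.isClosedMap (hopen φ hφ) hφf hfφ⟩
  -- A first factor of a perfect map is perfect when the intermediate space is Hausdorff.
  have hgf : IsProperMap (g ∘ f.toFun) := hfg ▸ hq
  exact isProperMap_of_comp_of_t2 f.continuous_toFun hg hgf
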